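/- Let $R$ be an associative ring with identity, let $\alpha$ be an automorphism of $R$ and let $\delta$ be an $\alpha$-derivation of $R$, i.e. an additive map with $\delta(ab)=\delta(a)b+\alpha(a)\delta(b)$ for all $a,b\in R$. Assume that $R$ is $(\alpha,\delta)$-compatible, i.e. for all $a,b\in R$ one has $ab=0\Leftrightarrow a\alpha(b)=0$, and $ab=0\Rightarrow a\delta(b)=0$. Let $R[[x^{-1};\alpha,\delta]]$ be the skew inverse power series ring: its elements are the formal series $\sum_{i\ge 0}a_ix^{-i}$ with $a_i\in R$, addition is coefficientwise, and multiplication is determined by $x^{-1}a=\sum_{i\ge 1}\alpha^{-1}(-\delta\alpha^{-1})^{i-1}(a)\,x^{-i}$ for $a\in R$. Call a ring $S$ right $\mathfrak{cP}$-Baer if for every cyclic projective right $S$-module $P$ the right annihilator $r_S(P)=\{s\in S : Ps=0\}$ equals $cS$ for some idempotent $c\in S$. Then $R$ is right $\mathfrak{cP}$-Baer if and only if $R[[x^{-1};\alpha,\delta]]$ is right $\mathfrak{cP}$-Baer. -/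

import Mathlib

universe u

/-- `R` is right cP-Baer: for every cyclic projective right `R`-module `P` (a module over `Rᵐᵒᵖ`),
the annihilator `r_R(P) = {r ∈ R | P r = 0}` is equal to `c R` for some idempotent `c` of `R`.
A cyclic module is a quotient of `R`, so modules in the universe of `R` suffice. -/
def IsRightCPBaer (R : Type u) [Ring R] : Prop :=
  ∀ (P : Type u) [AddCommGroup P] [Module Rᵐᵒᵖ P],
    (∃ p : P, Submodule.span Rᵐᵒᵖ {p} = ⊤) → Module.Projective Rᵐᵒᵖ P →
      ∃ c : R, IsIdempotentElem c ∧
        {r : R | ∀ p : P, MulOpposite.op r • p = 0} = {r : R | ∃ s : R, r = c * s}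

/-- An `α`-derivation: an additive map `δ` with `δ (a b) = δ a * b + α a * δ b`. -/
structure SkewDerivation {R : Type u} [Ring R] (α : R →+* R) extends R →+ R where
  leibniz' : ∀ a b : R, toFun (a * b) = toFun a * b + α a * toFun b

instance {R : Type u} [Ring R] (α : R →+* R) : CoeFun (SkewDerivation α) (fun _ => R → R) where
  coe δ := δ.toAddMonoidHom

/-- `R` is `α`-compatible: `a b = 0` if and only if `a α(b) = 0`. -/
def IsEndoCompatible {R : Type u} [Ring R] (α : R →+* R) : Prop :=
  ∀ a b : R, a * b = 0 ↔ a * α b = 0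

/-- `R` is `δ`-compatible: `a b = 0` implies `a δ(b) = 0`. -/
def IsDerivCompatible {R : Type u} [Ring R] {α : R →+* R} (δ : SkewDerivation α) : Prop :=
  ∀ a b : R, a * b = 0 → a * δ b = 0

/-- `R` is `(α, δ)`-compatible. -/
def IsSkewCompatible {R : Type u} [Ring R] (α : R →+* R) (δ : SkewDerivation α) : Prop :=
  IsEndoCompatible α ∧ IsDerivCompatible δ

/-- The skew inverse power series `∑_{i ≥ 0} a_i x^{-i}`, given by their coefficients
`coeff i = a_i`. -/
@[ext]
structure SkewInvPowerSeries {R : Type u} [Ring R] (α : R ≃+* R)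
    (δ : SkewDerivation (α : R →+* R)) : Type u where
  coeff : ℕ → R

namespace SkewInvPowerSeries

variable {R : Type u} [Ring R] (α : R ≃+* R) (δ : SkewDerivation (α : R →+* R))

/-- The additive endomorphism `α⁻¹` of `R`. -/
def invEnd : AddMonoid.End R := (α.symm : R ≃+ R).toAddMonoidHom

/-- The additive endomorphism `δ` of `R`. -/
def derEnd : AddMonoid.End R := δ.toAddMonoidHom

/-- The maps `d_i` with `x^{-1} a = ∑_i d_i(a) x^{-i}`: `d_0 = 0` and, for `i ≥ 1`,
`d_i = α⁻¹ (-δ α⁻¹)^(i-1)` (products are compositions). -/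
def invXCoeff : ℕ → AddMonoid.End R
  | 0 => 0
  | i + 1 => invEnd α * (-(derEnd α δ * invEnd α)) ^ i

/-- Left multiplication by `x^{-1}` on coefficient sequences:
`x^{-1} ∑_j f_j x^{-j} = ∑_{i, j} d_i(f_j) x^{-(i+j)}`. -/
def invXMul (f : ℕ → R) : ℕ → R := fun N =>
  ∑ p ∈ Finset.HasAntidiagonal.antidiagonal N, invXCoeff α δ p.1 (f p.2)

/-- The product `(∑_n f_n x^{-n}) g = ∑_n f_n (x^{-n} g)` on coefficient sequences; the
coefficient at `N` of `x^{-n} g` vanishes for `n > N`, so that the sum is finite. -/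
def mulSeq (f g : ℕ → R) : ℕ → R := fun N =>
  ∑ n ∈ Finset.range (N + 1), f n * ((invXMul α δ)^[n] g) N

/-- Auxiliary: right multiplication by `x^{-1}` on coefficient sequences. -/
def shift (f : ℕ → R) : ℕ → R
  | 0 => 0
  | n + 1 => f n

/-- Auxiliary: the coefficient sequence of a constant. -/
def constSeq (a : R) : ℕ → R
  | 0 => a
  | _ + 1 => 0

theorem invEnd_alpha (a : R) : invEnd α (α a) = a := α.symm_apply_apply a

theorem invXCoeff_alpha (i : ℕ) (a : R) :
    invXCoeff α δ (i + 1) (α a) = constSeq a i - invXCoeff α δ i (δ a) := by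
  cases i with
  | zero =>
    change invEnd α (α a) = a - 0
    rw [invEnd_alpha, sub_zero]
  | succ i =>
    have h : (-(derEnd α δ * invEnd α)) (α a) = -δ a :=
      congrArg (fun b => -δ b) (invEnd_alpha α a)
    simp only [invXCoeff, pow_succ]
    change invEnd α (((-(derEnd α δ * invEnd α)) ^ i) ((-(derEnd α δ * invEnd α)) (α a))) =
      0 - invEnd α (((-(derEnd α δ * invEnd α)) ^ i) (δ a))
    rw [h, map_neg, map_neg, zero_sub]

theorem der_mul (a b : R) : δ (a * b) = δ a * b + α a * δ b := δ.leibniz' a b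

theorem der_one : δ (1 : R) = 0 := by
  have h := der_mul α δ 1 1
  simpa using h

theorem invXMul_zero_coeff (f : ℕ → R) : invXMul α δ f 0 = 0 := by
  simp [invXMul, invXCoeff]

theorem invXMul_succ (f : ℕ → R) (N : ℕ) :
    invXMul α δ (fun j => α (f j)) (N + 1) = f N - invXMul α δ (fun j => δ (f j)) N := by
  unfold invXMul
  rw [Finset.Nat.antidiagonal_succ, Finset.sum_cons, Finset.sum_map]
  simp only [Function.Embedding.prodMap, Function.Embedding.coeFn_mk, Prod.map,
    Function.Embedding.refl_apply, Nat.succ_eq_add_one, invXCoeff_alpha, Finset.sum_sub_distrib]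
  have h : ∑ p ∈ Finset.HasAntidiagonal.antidiagonal N, constSeq (f p.2) p.1 = f N := by
    rw [Finset.sum_eq_single (0, N)]
    · rfl
    · rintro ⟨i, j⟩ hij hne
      cases i with
      | zero =>
        rw [Finset.HasAntidiagonal.mem_antidiagonal] at hij
        exact absurd (by simpa using hij) (fun h : j = N => hne (by rw [h]))
      | succ i => rfl
    · intro hN
      simp at hN
  rw [h]
  simp [invXCoeff]

theorem invXMul_add (f g : ℕ → R) : invXMul α δ (f + g) = invXMul α δ f + invXMul α δ g := by
  funext N
  simp [invXMul, Finset.sum_add_distrib]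

theorem invXMul_zero : invXMul α δ (0 : ℕ → R) = 0 := by
  funext N
  simp [invXMul]

theorem iter_add (n : ℕ) (f g : ℕ → R) :
    (invXMul α δ)^[n] (f + g) = (invXMul α δ)^[n] f + (invXMul α δ)^[n] g := by
  induction n generalizing f g with
  | zero => rfl
  | succ n ih => simp only [Function.iterate_succ_apply, invXMul_add, ih]

theorem iter_zero (n : ℕ) : (invXMul α δ)^[n] (0 : ℕ → R) = 0 := by
  induction n with
  | zero => rfl
  | succ n ih => rw [Function.iterate_succ_apply, invXMul_zero, ih]

theorem iter_vanish (n : ℕ) (g : ℕ → R) (N : ℕ) (h : N < n) : ((invXMul α δ)^[n] g) N = 0 := by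
  induction n generalizing N with
  | zero => omega
  | succ n ih =>
    rw [Function.iterate_succ_apply']
    unfold invXMul
    refine Finset.sum_eq_zero ?_
    rintro ⟨i, j⟩ hij
    rw [Finset.HasAntidiagonal.mem_antidiagonal] at hij
    cases i with
    | zero => simp [invXCoeff]
    | succ i =>
      simp only at hij
      have := ih j (by omega)
      unfold invXMul at this
      simp only [this, map_zero]

theorem mulSeq_eq (f g : ℕ → R) (N M : ℕ) (h : N < M) :
    mulSeq α δ f g N = ∑ n ∈ Finset.range M, f n * ((invXMul α δ)^[n] g) N := by
  unfold mulSeq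
  refine Finset.sum_subset (Finset.range_mono h) ?_
  intro n _ hn
  rw [iter_vanish α δ n g N (by simpa using hn), mul_zero]

theorem mulSeq_add (f g h : ℕ → R) :
    mulSeq α δ f (g + h) = mulSeq α δ f g + mulSeq α δ f h := by
  funext N
  simp [mulSeq, iter_add, mul_add, Finset.sum_add_distrib]

theorem add_mulSeq (f g h : ℕ → R) :
    mulSeq α δ (f + g) h = mulSeq α δ f h + mulSeq α δ g h := by
  funext N
  simp [mulSeq, add_mul, Finset.sum_add_distrib]

theorem mulSeq_zero (f : ℕ → R) : mulSeq α δ f 0 = 0 := by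
  funext N
  simp [mulSeq, iter_zero]

theorem zero_mulSeq (f : ℕ → R) : mulSeq α δ 0 f = 0 := by
  funext N
  simp [mulSeq]

theorem sub_mulSeq (f g h : ℕ → R) :
    mulSeq α δ (f - g) h = mulSeq α δ f h - mulSeq α δ g h := by
  rw [eq_sub_iff_add_eq, ← add_mulSeq, sub_add_cancel]

theorem mulSeq_sub (f g h : ℕ → R) :
    mulSeq α δ f (g - h) = mulSeq α δ f g - mulSeq α δ f h := by
  rw [eq_sub_iff_add_eq, ← mulSeq_add, sub_add_cancel]

theorem invXMul_shift (f : ℕ → R) : invXMul α δ (shift f) = shift (invXMul α δ f) := by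
  funext N
  cases N with
  | zero => rw [invXMul_zero_coeff]; rfl
  | succ N =>
    simp only [invXMul, shift]
    rw [Finset.Nat.antidiagonal_succ', Finset.sum_cons, Finset.sum_map]
    simp

theorem iter_shift (n : ℕ) (f : ℕ → R) :
    (invXMul α δ)^[n] (shift f) = shift ((invXMul α δ)^[n] f) := by
  induction n generalizing f with
  | zero => rfl
  | succ n ih => rw [Function.iterate_succ_apply, invXMul_shift, ih, Function.iterate_succ_apply]

theorem mulSeq_shift (f g : ℕ → R) : mulSeq α δ f (shift g) = shift (mulSeq α δ f g) := by
  funext N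
  cases N with
  | zero => simp [mulSeq, shift]
  | succ N =>
    simp only [mulSeq, iter_shift, shift]
    exact (mulSeq_eq α δ f g N (N + 1 + 1) (by omega)).symm

theorem shift_mulSeq (f g : ℕ → R) :
    mulSeq α δ (shift f) g = mulSeq α δ f (invXMul α δ g) := by
  funext N
  rw [mulSeq_eq α δ (shift f) g N (N + 1 + 1) (by omega), Finset.sum_range_succ']
  simp [shift, mulSeq, Function.iterate_succ_apply]

theorem constSeq_mulSeq (b : R) (g : ℕ → R) : mulSeq α δ (constSeq b) g = fun n => b * g n := by
  funext N
  rw [mulSeq, Finset.sum_range_succ']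
  simp [constSeq]

theorem invXCoeff_seq (b : R) :
    (fun n => invXCoeff α δ n (α b)) = shift (constSeq b - fun n => invXCoeff α δ n (δ b)) := by
  funext n
  cases n with
  | zero => simp [invXCoeff, shift]
  | succ n => rw [invXCoeff_alpha]; rfl

theorem invXMul_alpha (f : ℕ → R) :
    invXMul α δ (fun j => α (f j)) = shift (f - invXMul α δ (fun j => δ (f j))) := by
  funext n
  cases n with
  | zero => rw [invXMul_zero_coeff]; rfl
  | succ n => rw [invXMul_succ]; rfl

theorem invXMul_smul (N : ℕ) (b : R) (g : ℕ → R) :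
    invXMul α δ (fun j => b * g j) N = mulSeq α δ (fun n => invXCoeff α δ n b) g N := by
  induction N generalizing b g with
  | zero => rw [invXMul_zero_coeff]; simp [mulSeq, invXCoeff]
  | succ N ih =>
    obtain ⟨b, rfl⟩ := α.surjective b
    obtain ⟨g, rfl⟩ : ∃ g' : ℕ → R, g = fun j => α (g' j) :=
      ⟨fun j => α.symm (g j), by funext j; simp⟩
    have e1 : (fun j => α b * α (g j)) = fun j => α ((fun j => b * g j) j) := by
      funext j; simp
    have e2 : (fun j => δ ((fun j => b * g j) j)) =
        (fun j => δ b * g j) + fun j => α b * δ (g j) := by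
      funext j; exact der_mul α δ b (g j)
    rw [e1, invXMul_succ, e2, invXMul_add, Pi.add_apply, ih, ih, invXCoeff_seq,
      shift_mulSeq, shift_mulSeq, invXMul_alpha, mulSeq_shift, shift, sub_mulSeq, sub_mulSeq,
      mulSeq_sub, mulSeq_sub, constSeq_mulSeq, constSeq_mulSeq]
    simp only [Pi.sub_apply]
    abel

theorem invXMul_mulSeq (f g : ℕ → R) :
    invXMul α δ (mulSeq α δ f g) = mulSeq α δ (invXMul α δ f) g := by
  funext N
  have h1 : invXMul α δ (mulSeq α δ f g) N =
      ∑ n ∈ Finset.range (N + 1),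
        invXMul α δ (fun j => f n * ((invXMul α δ)^[n] g) j) N := by
    conv_lhs => unfold invXMul
    conv_rhs => enter [2, n]; rw [invXMul]
    rw [Finset.sum_comm]
    refine Finset.sum_congr rfl ?_
    rintro ⟨i, j⟩ hij
    rw [Finset.HasAntidiagonal.mem_antidiagonal] at hij
    simp only at hij
    have := mulSeq_eq α δ f g j (N + 1) (by omega)
    change invXCoeff α δ i (mulSeq α δ f g j) = _
    rw [this, map_sum]
  have h2 : ∀ n ∈ Finset.range (N + 1),
      invXMul α δ (fun j => f n * ((invXMul α δ)^[n] g) j) N =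
      ∑ k ∈ Finset.range (N + 1 - n),
        invXCoeff α δ k (f n) * ((invXMul α δ)^[k + n] g) N := by
    intro n _
    rw [invXMul_smul, mulSeq]
    simp only [← Function.iterate_add_apply]
    symm
    refine Finset.sum_subset (Finset.range_mono (by omega)) ?_
    intro k _ hk
    rw [Finset.mem_range] at hk
    rw [iter_vanish α δ (k + n) g N (by omega), mul_zero]
  rw [h1, Finset.sum_congr rfl h2, ← Finset.sum_range_diag_flip (N + 1)
    (fun n k => invXCoeff α δ k (f n) * ((invXMul α δ)^[k + n] g) N), mulSeq]
  refine Finset.sum_congr rfl ?_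
  intro m _
  conv_rhs => rw [invXMul]
  rw [← Finset.Nat.sum_antidiagonal_swap, Finset.Nat.sum_antidiagonal_eq_sum_range_succ_mk,
    Finset.sum_mul]
  refine Finset.sum_congr rfl ?_
  intro n hn
  rw [Finset.mem_range] at hn
  simp only [Prod.swap]
  rw [Nat.sub_add_cancel (by omega)]

theorem iter_mulSeq (n : ℕ) (f g : ℕ → R) :
    (invXMul α δ)^[n] (mulSeq α δ f g) = mulSeq α δ ((invXMul α δ)^[n] f) g := by
  induction n generalizing f with
  | zero => rfl
  | succ n ih => rw [Function.iterate_succ_apply, invXMul_mulSeq, ih, Function.iterate_succ_apply]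

theorem mulSeq_assoc (f g h : ℕ → R) :
    mulSeq α δ (mulSeq α δ f g) h = mulSeq α δ f (mulSeq α δ g h) := by
  funext N
  have h1 : ∀ m ∈ Finset.range (N + 1), mulSeq α δ f g m * ((invXMul α δ)^[m] h) N =
      ∑ n ∈ Finset.range (N + 1),
        f n * (((invXMul α δ)^[n] g) m * ((invXMul α δ)^[m] h) N) := by
    intro m hm
    rw [mulSeq_eq α δ f g m (N + 1) (by simpa using hm), Finset.sum_mul]
    simp only [mul_assoc]
  rw [mulSeq, Finset.sum_congr rfl h1, Finset.sum_comm, mulSeq]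
  refine Finset.sum_congr rfl ?_
  intro n _
  rw [iter_mulSeq, ← Finset.mul_sum]
  rfl

theorem one_mulSeq (f : ℕ → R) : mulSeq α δ (constSeq 1) f = f := by
  rw [constSeq_mulSeq]
  simp

theorem invXMul_one : invXMul α δ (constSeq 1) = shift (constSeq 1) := by
  have e1 : (constSeq (1 : R)) = fun j => α (constSeq (1 : R) j) := by
    funext j; cases j <;> simp [constSeq]
  have e2 : (fun j => δ (constSeq (1 : R) j)) = 0 := by
    funext j
    cases j with
    | zero => exact der_one α δ
    | succ j => exact map_zero δ.toAddMonoidHom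
  conv_lhs => rw [e1]
  rw [invXMul_alpha, e2, invXMul_zero, sub_zero]

theorem iter_one (n N : ℕ) :
    ((invXMul α δ)^[n] (constSeq 1)) N = if N = n then (1 : R) else 0 := by
  induction n generalizing N with
  | zero => cases N <;> simp [constSeq]
  | succ n ih =>
    rw [Function.iterate_succ_apply, invXMul_one, iter_shift]
    cases N with
    | zero => simp [shift]
    | succ N => simp [shift, ih]

theorem mulSeq_one (f : ℕ → R) : mulSeq α δ f (constSeq 1) = f := by
  funext N
  simp [mulSeq, iter_one]

variable {α δ}

instance : Zero (SkewInvPowerSeries α δ) := ⟨⟨fun _ => 0⟩⟩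

instance : One (SkewInvPowerSeries α δ) := ⟨⟨constSeq 1⟩⟩

instance : Add (SkewInvPowerSeries α δ) := ⟨fun f g => ⟨fun n => f.coeff n + g.coeff n⟩⟩

instance : Neg (SkewInvPowerSeries α δ) := ⟨fun f => ⟨fun n => -f.coeff n⟩⟩

instance : Mul (SkewInvPowerSeries α δ) := ⟨fun f g => ⟨mulSeq α δ f.coeff g.coeff⟩⟩

/-- The ring `R[[x⁻¹; α, δ]]`: coefficientwise addition, and the multiplication determined by
`x^{-1} a = ∑_{i ≥ 1} α⁻¹ (-δ α⁻¹)^(i-1) (a) x^{-i}`. -/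
instance : Ring (SkewInvPowerSeries α δ) where
  nsmul := nsmulRec
  zsmul := zsmulRec
  add_assoc f g h := SkewInvPowerSeries.ext (add_assoc f.coeff g.coeff h.coeff)
  zero_add f := SkewInvPowerSeries.ext (zero_add f.coeff)
  add_zero f := SkewInvPowerSeries.ext (add_zero f.coeff)
  add_comm f g := SkewInvPowerSeries.ext (add_comm f.coeff g.coeff)
  neg_add_cancel f := SkewInvPowerSeries.ext (neg_add_cancel f.coeff)
  left_distrib f g h := SkewInvPowerSeries.ext (mulSeq_add α δ f.coeff g.coeff h.coeff)
  right_distrib f g h := SkewInvPowerSeries.ext (add_mulSeq α δ f.coeff g.coeff h.coeff)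
  zero_mul f := SkewInvPowerSeries.ext (zero_mulSeq α δ f.coeff)
  mul_zero f := SkewInvPowerSeries.ext (mulSeq_zero α δ f.coeff)
  mul_assoc f g h := SkewInvPowerSeries.ext (mulSeq_assoc α δ f.coeff g.coeff h.coeff)
  one_mul f := SkewInvPowerSeries.ext (one_mulSeq α δ f.coeff)
  mul_one f := SkewInvPowerSeries.ext (mulSeq_one α δ f.coeff)

end SkewInvPowerSeries

/-! Write `S` for the series ring. A cyclic projective right module is some `e R` with `e`
idempotent, so the property says that every right annihilator `r(e R)` is generated by an
idempotent. An idempotent `ε` of `S` can be replaced by its constant coefficient `e`, an idempotent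
of `R`: a series that annihilates one of `ε S`, `e S` annihilates the other, because a series
without constant term cannot fix a nonzero series (`annihilator_of_coeff_zero_eq`). Compatibility
makes `α⁻¹` and `δ` preserve the equations `a b = 0`, hence `r_S(e S)` is computed coefficientwise
from `r_R(e R)` (`annihilator_const_iff`). A generator `c` over `R` then serves over `S` as a
constant; a generator over `S` yields its constant coefficient. -/

/-- A cyclic projective right module is isomorphic to `e R` for an idempotent `e`, so that right
cP-Baer rings are described by the right annihilators of the right ideals `e R`. -/
theorem isRightCPBaer_iff_idempotent {R : Type u} [Ring R] :
    IsRightCPBaer R ↔ ∀ e : R, IsIdempotentElem e →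
      ∃ c : R, IsIdempotentElem c ∧ ∀ r : R, (∀ s : R, e * s * r = 0) ↔ ∃ s : R, r = c * s := by
  constructor
  · intro h e he
    -- This is `e R`, viewed as a left ideal of `Rᵐᵒᵖ`.
    let P : Submodule Rᵐᵒᵖ Rᵐᵒᵖ := Submodule.span Rᵐᵒᵖ {MulOpposite.op e}
    let p : P := ⟨MulOpposite.op e, Submodule.mem_span_singleton_self _⟩
    have hp : ∀ x : P, ∃ s : R, x = MulOpposite.op s • p := by
      intro x
      obtain ⟨a, ha⟩ := Submodule.mem_span_singleton.1 x.2
      exact ⟨a.unop, Subtype.ext ha.symm⟩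
    have hcyc : ∃ p : P, Submodule.span Rᵐᵒᵖ {p} = ⊤ := by
      refine ⟨p, Submodule.eq_top_iff'.2 fun x => ?_⟩
      obtain ⟨s, hs⟩ := hp x
      exact Submodule.mem_span_singleton.2 ⟨_, hs.symm⟩
    have hproj : Module.Projective Rᵐᵒᵖ P := by
      -- The map `1 ↦ p` is left multiplication by `e` on `R`; it retracts the inclusion of `e R`
      -- since `e` is idempotent.
      refine Module.Projective.of_split P.subtype (LinearMap.toSpanSingleton Rᵐᵒᵖ P p) ?_
      ext x
      obtain ⟨s, rfl⟩ := hp x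
      change (MulOpposite.op s * MulOpposite.op e) * MulOpposite.op e = _
      rw [mul_assoc, ← MulOpposite.op_mul, he.eq]
      rfl
    obtain ⟨c, hc, hann⟩ := h P hcyc hproj
    refine ⟨c, hc, fun r => Iff.trans ?_ (Set.ext_iff.1 hann r)⟩
    have key : ∀ s : R, MulOpposite.op r • MulOpposite.op s • p = 0 ↔ e * s * r = 0 := by
      intro s
      rw [Subtype.ext_iff]
      change MulOpposite.op (e * s * r) = MulOpposite.op 0 ↔ _
      exact MulOpposite.op_inj
    constructor
    · intro hr x
      obtain ⟨s, rfl⟩ := hp x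
      exact (key s).2 (hr s)
    · intro hr s
      exact (key s).1 (hr _)
  · intro h P _ _ hcyc hproj
    obtain ⟨p, hp⟩ := hcyc
    have hsurj : ∀ x : P, ∃ a : Rᵐᵒᵖ, a • p = x := fun x =>
      Submodule.mem_span_singleton.1 (hp ▸ Submodule.mem_top)
    -- A section `g` of the surjection `1 ↦ p` embeds `P` in `Rᵐᵒᵖ`; its value at `p` is the
    -- required idempotent, as `g p * g p = g (g p • p) = g p`.
    obtain ⟨g, hg⟩ := Module.projective_lifting_property
      (LinearMap.toSpanSingleton Rᵐᵒᵖ P p) LinearMap.id hsurj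
    have hgp : g p • p = p := LinearMap.congr_fun hg p
    have hinj : ∀ x : P, g x = 0 → x = 0 := by
      intro x hx
      have h1 : g x • p = x := LinearMap.congr_fun hg x
      rw [← h1, hx, zero_smul]
    have he : IsIdempotentElem (g p).unop := by
      have h1 : g p * g p = g p := by
        rw [← smul_eq_mul, ← map_smul, hgp]
      exact congrArg MulOpposite.unop h1
    obtain ⟨c, hc, hann⟩ := h _ he
    refine ⟨c, hc, Set.ext fun r => Iff.trans ?_ (hann r)⟩
    have key : ∀ s : R, MulOpposite.op r • MulOpposite.op s • p = 0 ↔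
        (g p).unop * s * r = 0 := by
      intro s
      have h1 : g (MulOpposite.op r • MulOpposite.op s • p) =
          MulOpposite.op ((g p).unop * s * r) := by
        rw [map_smul, map_smul]
        rfl
      rw [← MulOpposite.op_eq_zero_iff ((g p).unop * s * r), ← h1]
      exact ⟨fun h2 => by rw [h2, map_zero], hinj _⟩
    constructor
    · intro hr s
      exact (key s).1 (hr _)
    · intro hr x
      obtain ⟨a, rfl⟩ := hsurj x
      exact (key a.unop).2 (hr _)

/-! ### Constant coefficients of idempotents and the order of a series. -/

namespace SkewInvPowerSeries

variable {R : Type u} [Ring R] {α : R ≃+* R} {δ : SkewDerivation (α : R →+* R)}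

theorem coeff_zero (n : ℕ) : (0 : SkewInvPowerSeries α δ).coeff n = 0 := rfl

theorem coeff_sub (f g : SkewInvPowerSeries α δ) (n : ℕ) :
    (f - g).coeff n = f.coeff n - g.coeff n := by
  rw [sub_eq_add_neg, sub_eq_add_neg]
  rfl

theorem coeff_mul (f g : SkewInvPowerSeries α δ) (N : ℕ) :
    (f * g).coeff N =
      ∑ n ∈ Finset.range (N + 1), f.coeff n * ((invXMul α δ)^[n] g.coeff) N := rfl

theorem coeff_mul_zero (f g : SkewInvPowerSeries α δ) :
    (f * g).coeff 0 = f.coeff 0 * g.coeff 0 := by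
  simp [coeff_mul]

/-- The constant series with value `a`. -/
def const (a : R) : SkewInvPowerSeries α δ := ⟨constSeq a⟩

theorem coeff_const_zero (a : R) : (const a : SkewInvPowerSeries α δ).coeff 0 = a := rfl

theorem coeff_const_mul (a : R) (f : SkewInvPowerSeries α δ) (n : ℕ) :
    (const a * f).coeff n = a * f.coeff n :=
  congrFun (constSeq_mulSeq α δ a f.coeff) n

theorem isIdempotentElem_const {e : R} (he : IsIdempotentElem e) :
    IsIdempotentElem (const e : SkewInvPowerSeries α δ) := by
  refine SkewInvPowerSeries.ext (funext fun n => ?_)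
  rw [coeff_const_mul]
  cases n with
  | zero => exact he
  | succ n => exact mul_zero e

theorem isIdempotentElem_coeff_zero {ε : SkewInvPowerSeries α δ} (hε : IsIdempotentElem ε) :
    IsIdempotentElem (ε.coeff 0) := by
  rw [IsIdempotentElem, ← coeff_mul_zero, hε.eq]

/-- Since `d_0 = 0`, multiplication by `x^{-1}` raises the order of a series by at least one. -/
theorem invXMul_vanish {f : ℕ → R} {N : ℕ} (hf : ∀ j < N, f j = 0) :
    ∀ j < N + 1, invXMul α δ f j = 0 := by
  intro M hM
  refine Finset.sum_eq_zero ?_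
  rintro ⟨i, j⟩ hij
  rw [Finset.HasAntidiagonal.mem_antidiagonal] at hij
  simp only at hij ⊢
  cases i with
  | zero => simp [invXCoeff]
  | succ i => rw [hf j (by omega), map_zero]

theorem iter_vanish_of_vanish {f : ℕ → R} {N : ℕ} (hf : ∀ j < N, f j = 0) (n : ℕ) :
    ∀ j < N + n, ((invXMul α δ)^[n] f) j = 0 := by
  induction n with
  | zero => exact hf
  | succ n ih =>
    rw [Function.iterate_succ_apply']
    exact invXMul_vanish ih

/-- A series with zero constant coefficient fixes only the zero series. -/
theorem eq_zero_of_eq_mul {t h : SkewInvPowerSeries α δ} (ht : t.coeff 0 = 0) (hh : h = t * h) :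
    h = 0 := by
  have key : ∀ N, h.coeff N = 0 := by
    intro N
    induction N using Nat.strong_induction_on with
    | _ N ih =>
      rw [hh, coeff_mul]
      refine Finset.sum_eq_zero fun n _ => ?_
      cases n with
      | zero => rw [ht, zero_mul]
      -- By induction `h` has order at least `N`, so `x^{-(n+1)} h` has no coefficient at `N`.
      | succ n => rw [iter_vanish_of_vanish ih (n + 1) N (by omega), mul_zero]
  exact SkewInvPowerSeries.ext (funext key)

/-- Idempotents with the same constant coefficient generate right ideals with the same right
annihilator. -/
theorem annihilator_of_coeff_zero_eq {ε η : SkewInvPowerSeries α δ} (hε : IsIdempotentElem ε)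
    (h0 : ε.coeff 0 = η.coeff 0) {f : SkewInvPowerSeries α δ} (hf : ∀ g, η * g * f = 0)
    (g : SkewInvPowerSeries α δ) : ε * g * f = 0 := by
  -- With `e` the common constant coefficient, `ε - ε η ε` has constant coefficient `e - e³ = 0`. It
  -- fixes `ε g f`, because `η S f = 0` kills the second term.
  refine eq_zero_of_eq_mul (t := ε - ε * η * ε) ?_ ?_
  · have h1 := (isIdempotentElem_coeff_zero hε).eq
    rw [coeff_sub, coeff_mul_zero, coeff_mul_zero, ← h0, h1, h1, sub_self]
  · have h1 : (ε - ε * η * ε) * (ε * g * f) = ε * ε * g * f - ε * (η * (ε * ε * g) * f) := by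
      noncomm_ring
    rw [h1, hf, mul_zero, sub_zero, hε.eq]

/-! ### Compatibility and annihilators of constants. -/

/-- Each `d_i` with `i ≥ 1` is, up to sign, a composite of `α⁻¹` and `δ`. Both preserve the right
annihilator of `a`; for `α⁻¹`, apply `α`-compatibility to `a α(α⁻¹ b) = a b`. -/
theorem mul_invXCoeff_eq_zero (hc : IsSkewCompatible (α : R →+* R) δ) {a b : R} (h : a * b = 0)
    (i : ℕ) : a * invXCoeff α δ i b = 0 := by
  have hinv : ∀ b : R, a * b = 0 → a * invEnd α b = 0 := by
    intro b hb
    refine (hc.1 a _).2 ?_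
    rw [← hb]
    exact congrArg (a * ·) (α.apply_symm_apply b)
  cases i with
  | zero => exact mul_zero a
  | succ i =>
    refine hinv _ ?_
    induction i with
    | zero => exact h
    | succ i ih =>
      rw [pow_succ']
      change a * -(δ (invEnd α (((-(derEnd α δ * invEnd α)) ^ i) b))) = 0
      exact (mul_neg _ _).trans (neg_eq_zero.2 (hc.2 a _ (hinv _ ih)))

theorem mul_iter_eq_zero (hc : IsSkewCompatible (α : R →+* R) δ) {a : R} {f : ℕ → R}
    (h : ∀ j, a * f j = 0) (n : ℕ) : ∀ j, a * ((invXMul α δ)^[n] f) j = 0 := by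
  induction n with
  | zero => exact h
  | succ n ih =>
    intro j
    rw [Function.iterate_succ_apply', invXMul, Finset.mul_sum]
    exact Finset.sum_eq_zero fun p _ => mul_invXCoeff_eq_zero hc (ih p.2) p.1

/-- The right annihilator of `e S`, for `S = R[[x⁻¹; α, δ]]` and `e` in `R`, consists of the series
with coefficients in the right annihilator of `e R`. -/
theorem annihilator_const_iff (hc : IsSkewCompatible (α : R →+* R) δ) (e : R)
    (f : SkewInvPowerSeries α δ) :
    (∀ g : SkewInvPowerSeries α δ, const e * g * f = 0) ↔
      ∀ (n : ℕ) (s : R), e * s * f.coeff n = 0 := by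
  constructor
  · intro h n s
    have h1 := congrArg (fun k => coeff k n) (h (const s))
    simpa only [mul_assoc, coeff_const_mul, coeff_zero] using h1
  · intro h g
    refine SkewInvPowerSeries.ext (funext fun N => ?_)
    rw [coeff_mul]
    refine Finset.sum_eq_zero fun n _ => ?_
    rw [coeff_const_mul]
    -- The element `e * g_n` annihilates every coefficient of `f`, hence every coefficient of
    -- `x^{-n} f`.
    exact mul_iter_eq_zero hc (fun j => h j _) n N

theorem exists_eq_const_mul_iff {c : R} (hc : IsIdempotentElem c) (f : SkewInvPowerSeries α δ) :
    (∃ g : SkewInvPowerSeries α δ, f = const c * g) ↔ ∀ n, ∃ s, f.coeff n = c * s := by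
  constructor
  · rintro ⟨g, rfl⟩ n
    exact ⟨g.coeff n, coeff_const_mul c g n⟩
  · intro h
    -- As `c` is idempotent, it fixes `c R`, so `f` is its own cofactor.
    refine ⟨f, SkewInvPowerSeries.ext (funext fun n => ?_)⟩
    obtain ⟨s, hs⟩ := h n
    rw [coeff_const_mul, hs, ← mul_assoc, hc.eq]

end SkewInvPowerSeries

open SkewInvPowerSeries in
theorem theorem24 {R : Type u} [Ring R] (α : R ≃+* R) (δ : SkewDerivation (α : R →+* R))
    (hc : IsSkewCompatible (α : R →+* R) δ) :
    IsRightCPBaer R ↔ IsRightCPBaer (SkewInvPowerSeries α δ) := by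
  rw [isRightCPBaer_iff_idempotent, isRightCPBaer_iff_idempotent]
  constructor
  · intro h ε hε
    have he := isIdempotentElem_coeff_zero hε
    obtain ⟨c, hci, hann⟩ := h _ he
    refine ⟨const c, isIdempotentElem_const hci, fun f => ?_⟩
    rw [exists_eq_const_mul_iff hci]
    simp only [← hann]
    rw [← annihilator_const_iff hc]
    -- `ε` and the constant `ε.coeff 0` are idempotents with the same constant coefficient, so the
    -- comparison applies in both directions.
    exact ⟨annihilator_of_coeff_zero_eq (η := ε) (isIdempotentElem_const he) rfl,
      annihilator_of_coeff_zero_eq (η := const (ε.coeff 0)) hε rfl⟩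
  · intro h e he
    obtain ⟨γ, hγ, hann⟩ := h (const e) (isIdempotentElem_const he)
    refine ⟨γ.coeff 0, isIdempotentElem_coeff_zero hγ, fun r => ⟨fun hr => ?_, ?_⟩⟩
    · have h1 : ∀ g : SkewInvPowerSeries α δ, const e * g * const r = 0 := by
        refine (annihilator_const_iff hc e _).2 fun n s => ?_
        cases n with
        | zero => exact hr s
        | succ n => exact mul_zero _
      obtain ⟨g, hg⟩ := (hann _).1 h1
      exact ⟨g.coeff 0, by rw [← coeff_mul_zero, ← hg, coeff_const_zero]⟩
    · rintro ⟨s, rfl⟩ t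
      -- The generator `γ` lies in its own right ideal, so its coefficient at `0` lies in `r_R(e
      -- R)`.
      have h1 := (annihilator_const_iff hc e γ).1 ((hann γ).2 ⟨1, (mul_one γ).symm⟩) 0 t
      rw [← mul_assoc, h1, zero_mul]
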